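/- Let $\mathbb T=\mathbb R/\mathbb Z$ with the periodic distance $|x-y|_{\rm per}$. A measure $\sigma$ on $\mathbb T$ is upper $\alpha$-Ahlfors regular if there is $M>0$ with $\sigma(B_r(x))\le M r^\alpha$ for all $x\in\operatorname{supp}\sigma$ and $r\in(0,1]$. For a finite signed measure $\sigma$ on $\mathbb T$ let $\widehat\sigma_k=\int_{\mathbb T}e^{2\pi i kx}\,d\sigma(x)$ and $\|\sigma\|_{\dot H^{-s}}^2=\sum_{k\in\mathbb Z}|k|^{-2s}|\widehat\sigma_k|^2\in[0,\infty]$ (for $s>0$ the term $k=0$ is $0$ if $\sigma(\mathbb T)=0$ and $\infty$ otherwise). For probability measures $\mu_0,\nu_0$ on $\mathbb R$ let $$W^2(\mu_0,\nu_0)=\min_{\pi}\int_{\mathbb R\times\mathbb R}|x-y|^2\,d\pi ,$$ the minimum being over the measures $\pi$ on $\mathbb R\times\mathbb R$ with marginals $\mu_0,\nu_0$; minimizers are called optimal plans. We say that a measure $m$ on $\mathbb R$ represents a measure $\sigma$ on $\mathbb T$ on $[a,a+1]$ if $m$ is concentrated on $[a,a+1]$ and its image under $\mathbb R\to\mathbb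 T$ is $\sigma$. Let $s\in(0,1)$ and $\alpha\in[0,1]$ with $\alpha>1-2s$, let $\mu$ be an upper $\alpha$-Ahlfors regular probability measure on $\mathbb T$, let $\lambda\in(0,1)$ and let $\theta<s-\frac{1-\alpha}{2}$. Then there is a constant $C$, depending only on $s,\lambda,\theta$ and $\mu$, such that the following holds for every probability measure $\nu$ on $\mathbb T$. Let $a\in\mathbb R$, let $\mu_0,\nu_0$ represent $\mu,\nu$ on $[a,a+1]$, let $\pi$ be an optimal plan for $W(\mu_0,\nu_0)$, and let $\mu^\lambda=F_\lambda\#\pi$ with $F_\lambda(x,y)=(1-\lambda)x+\lambda y$, regarded as a measure on $\mathbb T$. Then $$\|\mu-\mu^\lambda\|_{\dot H^{-s}}\le C\,W(\mu_0,\nu_0)^\theta .$$ -/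

import Mathlib

open MeasureTheory
open scoped ENNReal NNReal

noncomputable section

/-- A measure `σ` on the torus `𝕋 = ℝ/ℤ` is upper `α`-Ahlfors regular if for some `M > 0` one has
`σ (B_r(x)) ≤ M r ^ α` for all `x ∈ supp σ` and `r ∈ (0, 1]`. Balls are those of the periodic
distance, which is the metric of `UnitAddCircle`. -/
def UpperAhlforsRegular (α : ℝ) (σ : Measure UnitAddCircle) : Prop :=
  ∃ M : ℝ, 0 < M ∧ ∀ x ∈ σ.support, ∀ r ∈ Set.Ioc (0 : ℝ) 1,
    σ (Metric.ball x r) ≤ ENNReal.ofReal (M * r ^ α)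

/-- The Fourier coefficient `∫ exp (2πikx) dσ(x)` of a finite signed measure on `𝕋`. -/
def measureFourierCoeff (σ : SignedMeasure UnitAddCircle) (k : ℤ) : ℂ :=
  ∫ᵛ x, fourier k x ∂<•σ

/-- The homogeneous negative Sobolev norm
`‖σ‖_{Ḣ^{-s}} = (∑_{k ∈ ℤ} |k|^{-2s} |σ̂_k|²)^{1/2} ∈ [0, ∞]` of a finite signed measure on `𝕋`.
For `s > 0` the term `k = 0` is `∞ * |σ(𝕋)|²`, that is, `0` if `σ(𝕋) = 0` and `∞` otherwise. -/
def negSobolevNorm (s : ℝ) (σ : SignedMeasure UnitAddCircle) : ℝ≥0∞ :=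
  (∑' k : ℤ, ‖(k : ℝ)‖ₑ ^ (-(2 * s)) * ‖measureFourierCoeff σ k‖ₑ ^ 2) ^ (1 / 2 : ℝ)

/-- `π` is a transport plan (coupling) between `μ₁` and `μ₂`. -/
def IsTransportPlan (π : Measure (ℝ × ℝ)) (μ₁ μ₂ : Measure ℝ) : Prop :=
  π.map Prod.fst = μ₁ ∧ π.map Prod.snd = μ₂

/-- The quadratic cost `∫ |x - y|² dπ` of a plan. -/
def transportCost (π : Measure (ℝ × ℝ)) : ℝ≥0∞ :=
  ∫⁻ p, ‖p.1 - p.2‖ₑ ^ 2 ∂π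

/-- The (Euclidean) quadratic Wasserstein distance of two measures on `ℝ`. -/
def wassersteinDist (μ₁ μ₂ : Measure ℝ) : ℝ≥0∞ :=
  (⨅ (π : Measure (ℝ × ℝ)) (_ : IsTransportPlan π μ₁ μ₂), transportCost π) ^ (1 / 2 : ℝ)

/-- `π` is an optimal transport plan for `W(μ₁, μ₂)`: a plan of minimal cost. -/
def IsOptimalPlan (π : Measure (ℝ × ℝ)) (μ₁ μ₂ : Measure ℝ) : Prop :=
  IsTransportPlan π μ₁ μ₂ ∧
    ∀ π' : Measure (ℝ × ℝ), IsTransportPlan π' μ₁ μ₂ → transportCost π ≤ transportCost π'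

/-- The McCann interpolant `F_lam # π`, where `F_lam (x, y) = (1 - lam) x + lam y`. -/
def mcCannInterpolant (lam : ℝ) (π : Measure (ℝ × ℝ)) : Measure ℝ :=
  π.map (fun p => (1 - lam) * p.1 + lam * p.2)

/-- The measure on `𝕋 = ℝ/ℤ` induced by a measure on `ℝ`. -/
def toTorus (m : Measure ℝ) : Measure UnitAddCircle :=
  m.map (fun x : ℝ => (x : UnitAddCircle))

instance (lam : ℝ) (π : Measure (ℝ × ℝ)) [IsFiniteMeasure π] :
    IsFiniteMeasure (mcCannInterpolant lam π) := by
  unfold mcCannInterpolant; infer_instance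

instance (m : Measure ℝ) [IsFiniteMeasure m] : IsFiniteMeasure (toTorus m) := by
  unfold toTorus; infer_instance

/-- `m` represents the measure `σ` on `𝕋` as a measure on the line, with the torus cut open at the
origin `a`: it is concentrated on the period `[a, a + 1]` and induces `σ` on `𝕋`. -/
def IsRepresentative (a : ℝ) (m : Measure ℝ) (σ : Measure UnitAddCircle) : Prop :=
  m (Set.Icc a (a + 1))ᶜ = 0 ∧ toTorus m = σ

end

/-!
The Fourier coefficients of `μ - μ^λ` are estimated in blocks of frequencies `|k| ≤ N`.

The basic tool is a large sieve inequality, `BallBound.sum_enorm_integral_fourier_sq_le`: if the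
image under `z` of a measure `P` gives mass at most `K r ^ α` to every ball of radius `r`, then
`∑_{|k| ≤ N} |∫ exp (2πikz) g dP|² ≤ 36 K N ^ (1 - α) ∫ g² dP`. It is proved by expanding squares
against the squared Dirichlet kernel and applying Schur's test; the ball bound enters in the
estimate of the kernel (`BallBound.lintegral_dirichletSum_sq_le`).

The ball bound holds uniformly along the interpolation. Indeed an optimal plan on the line is
monotone (`IsOptimalPlan.ae_monotone`), so that the point `x` is a Lipschitz function of
`z_τ = (1 - τ) x + τ y` with constant `(1 - τ)⁻¹ ≤ (1 - λ)⁻¹`, and the regularity of `μ` passes to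
all the interpolants with `τ ≤ λ` (`measure_interpolant_interval_le`, `ballBound_interpPoint`).

The large sieve is used twice (`sum_enorm_fourier_sub_sq_le`). With `g = 1` for `τ = 0` and `τ = λ`
it bounds the block by a multiple of `N ^ (1 - α)`. Since
`exp (2πikz_λ) - exp (2πikx) = 2πik ∫₀^λ exp (2πikz_τ) (y - x) dτ`, the sieve for the measure
`π ⊗ dτ` with `g = y - x` also gives a bound by a multiple of `N ^ (1 - α) N² W²`. Hence the block
is at most a multiple of `N ^ (1 - α) min (1, N² W²) ≤ N ^ (1 - α) (N W) ^ (2θ)` when `0 ≤ θ ≤ 1`.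
Multiplying by `N ^ (-2s)` and summing over `N = 2 ^ j` gives a geometric series, convergent since
`θ < s - (1 - α) / 2` (`exists_tsum_enorm_fourier_sub_le`). Negative `θ` reduce to `θ = 0` because
`W ≤ 1`.
-/

/-! ### Monotonicity of optimal plans on the line -/

theorem lintegral_restrict_prod_fst {Ω : Type*} [MeasurableSpace Ω] {π : Measure Ω}
    [IsFiniteMeasure π] {S : Set (Ω × Ω)} (hS : MeasurableSet S) {f : Ω → ℝ≥0∞}
    (hf : Measurable f) :
    ∫⁻ w, f w.1 ∂(π.prod π).restrict S = ∫⁻ p, π (Prod.mk p ⁻¹' S) * f p ∂π := by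
  rw [← lintegral_indicator hS, lintegral_prod _ (by fun_prop (disch := assumption))]
  refine lintegral_congr fun p => ?_
  have : (fun q => S.indicator (fun w : Ω × Ω => f w.1) (p, q))
      = (Prod.mk p ⁻¹' S).indicator fun _ => f p := by
    ext q; simp only [Set.indicator]; rfl
  rw [this, lintegral_indicator_const (measurable_prodMk_left hS), mul_comm]

theorem lintegral_restrict_prod_swap {Ω : Type*} [MeasurableSpace Ω] {π : Measure Ω}
    [IsFiniteMeasure π] {S : Set (Ω × Ω)} (hS : MeasurableSet S)
    (hsymm : Prod.swap ⁻¹' S = S) {f : Ω × Ω → ℝ≥0∞} (hf : Measurable f) :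
    ∫⁻ w, f w.swap ∂(π.prod π).restrict S = ∫⁻ w, f w ∂(π.prod π).restrict S := by
  have h : ((π.prod π).restrict S).map Prod.swap = (π.prod π).restrict S := by
    conv_lhs => rw [← hsymm]
    rw [← Measure.restrict_map measurable_swap hS, Measure.prod_swap]
  conv_rhs => rw [← h]
  rw [lintegral_map hf measurable_swap]

/-- The plan obtained from `π` by exchanging the targets `y, y'` of all pairs
`((x, y), (x', y'))` in `S` at once, the pairs being weighted by `π ⊗ π`. For a probability measure
`π` a point `p` takes part with the fraction `π {q | (p, q) ∈ S} ≤ 1` of its mass. If `S` is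
symmetric, only the movement of `(x, y)` to `(x, y')` has to be written down. -/
noncomputable def exchangePlan (π : Measure (ℝ × ℝ)) (S : Set ((ℝ × ℝ) × (ℝ × ℝ))) :
    Measure (ℝ × ℝ) :=
  π.withDensity (fun p => 1 - π (Prod.mk p ⁻¹' S)) +
    ((π.prod π).restrict S).map (fun w => (w.1.1, w.2.2))

theorem lintegral_exchangePlan {π : Measure (ℝ × ℝ)} [IsFiniteMeasure π]
    {S : Set ((ℝ × ℝ) × (ℝ × ℝ))} (hS : MeasurableSet S) {f : ℝ × ℝ → ℝ≥0∞} (hf : Measurable f) :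
    ∫⁻ p, f p ∂exchangePlan π S = ∫⁻ p, (1 - π (Prod.mk p ⁻¹' S)) * f p ∂π +
      ∫⁻ w, f (w.1.1, w.2.2) ∂(π.prod π).restrict S := by
  rw [exchangePlan, lintegral_add_measure, lintegral_map hf (by fun_prop),
    lintegral_withDensity_eq_lintegral_mul (f := fun p => 1 - π (Prod.mk p ⁻¹' S)) _
      (measurable_const.sub (measurable_measure_prodMk_left hS)) hf]
  rfl

/-- Splitting the mass of `π` into the part that takes part in an exchange and the rest. -/
theorem lintegral_add_lintegral_restrict_prod {Ω : Type*} [MeasurableSpace Ω] {π : Measure Ω}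
    [IsProbabilityMeasure π] {S : Set (Ω × Ω)} (hS : MeasurableSet S) {f : Ω → ℝ≥0∞}
    (hf : Measurable f) :
    ∫⁻ p, (1 - π (Prod.mk p ⁻¹' S)) * f p ∂π + ∫⁻ w, f w.1 ∂(π.prod π).restrict S
      = ∫⁻ p, f p ∂π := by
  have hm := measurable_measure_prodMk_left (ν := π) hS
  rw [lintegral_restrict_prod_fst hS hf, 
    ← lintegral_add_right (g := fun p => π (Prod.mk p ⁻¹' S) * f p) _ (hm.mul hf)]
  refine lintegral_congr fun p => ?_
  rw [← add_mul, tsub_add_cancel_of_le prob_le_one, one_mul]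

theorem IsTransportPlan.exchangePlan {π : Measure (ℝ × ℝ)} [IsProbabilityMeasure π]
    {μ₁ μ₂ : Measure ℝ} (h : IsTransportPlan π μ₁ μ₂) {S : Set ((ℝ × ℝ) × (ℝ × ℝ))}
    (hS : MeasurableSet S) (hsymm : Prod.swap ⁻¹' S = S) :
    IsTransportPlan (exchangePlan π S) μ₁ μ₂ := by
  obtain ⟨h₁, h₂⟩ := h
  constructor
  · rw [← h₁]
    refine Measure.ext_of_lintegral _ fun f hf => ?_
    have hf' : Measurable fun p : ℝ × ℝ => f p.1 := by fun_prop
    rw [lintegral_map hf measurable_fst, lintegral_map hf measurable_fst,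
      lintegral_exchangePlan hS hf', ← lintegral_add_lintegral_restrict_prod hS hf']
  · rw [← h₂]
    refine Measure.ext_of_lintegral _ fun f hf => ?_
    have hf' : Measurable fun p : ℝ × ℝ => f p.2 := by fun_prop
    rw [lintegral_map hf measurable_snd, lintegral_map hf measurable_snd,
      lintegral_exchangePlan hS hf', ← lintegral_add_lintegral_restrict_prod hS hf',
      ← lintegral_restrict_prod_swap hS hsymm (f := fun w => f w.1.2) (by fun_prop)]
    rfl

theorem enorm_sq_eq_ofReal_sq (x : ℝ) : ‖x‖ₑ ^ 2 = ENNReal.ofReal (x ^ 2) := by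
  rw [Real.enorm_eq_ofReal_abs, ← ENNReal.ofReal_pow (abs_nonneg x), sq_abs]

/-- An optimal plan on the line is monotone. The competitor exchanges the targets of all the pairs
of points in the wrong order at once; the exchange gains `-2 (x - x') (y - y')` for each pair, so
that a set of such pairs of positive measure contradicts optimality. -/
theorem IsOptimalPlan.ae_monotone {π : Measure (ℝ × ℝ)} [IsProbabilityMeasure π]
    {μ₁ μ₂ : Measure ℝ} (h : IsOptimalPlan π μ₁ μ₂) (hfin : transportCost π ≠ ∞) :
    ∀ᵐ p ∂π, ∀ᵐ q ∂π, 0 ≤ (p.1 - q.1) * (p.2 - q.2) := by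
  set S : Set ((ℝ × ℝ) × (ℝ × ℝ)) := {w | (w.1.1 - w.2.1) * (w.1.2 - w.2.2) < 0} with hSdef
  have hS : MeasurableSet S := measurableSet_lt (by fun_prop) (by fun_prop)
  have hsymm : Prod.swap ⁻¹' S = S := by
    ext w
    simp only [hSdef, Set.mem_preimage, Set.mem_ofPred_eq, Prod.fst_swap, Prod.snd_swap]
    rw [← neg_sub w.1.1, ← neg_sub w.1.2, neg_mul_neg]
  set c : ℝ × ℝ → ℝ≥0∞ := fun p => ‖p.1 - p.2‖ₑ ^ 2 with hc
  have hcm : Measurable c := by fun_prop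
  set ν := (π.prod π).restrict S
  have hsplit := lintegral_add_lintegral_restrict_prod (π := π) hS hcm
  have hfin' : ∫⁻ p, c p ∂π ≠ ∞ := hfin
  have hrest : ∫⁻ p, (1 - π (Prod.mk p ⁻¹' S)) * c p ∂π ≠ ∞ :=
    ne_top_of_le_ne_top hfin' (hsplit ▸ le_self_add)
  have hdiag : ∫⁻ w, c w.1 ∂ν ≠ ∞ := ne_top_of_le_ne_top hfin' (hsplit ▸ le_add_self)
  have hle : ∫⁻ w, c w.1 ∂ν ≤ ∫⁻ w, c (w.1.1, w.2.2) ∂ν := by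
    have := h.2 _ (h.1.exchangePlan hS hsymm)
    rw [transportCost, transportCost, lintegral_exchangePlan hS hcm, ← hsplit] at this
    exact (ENNReal.add_le_add_iff_left hrest).1 this
  have hle2 : ∫⁻ w, (c w.1 + c w.2) ∂ν ≤ ∫⁻ w, (c (w.1.1, w.2.2) + c (w.2.1, w.1.2)) ∂ν := by
    rw [lintegral_add_left (by fun_prop), lintegral_add_left (by fun_prop)]
    have e1 := lintegral_restrict_prod_swap (π := π) hS hsymm (f := fun w => c w.1) (by fun_prop)
    have e2 := lintegral_restrict_prod_swap (π := π) hS hsymm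
      (f := fun w => c (w.1.1, w.2.2)) (by fun_prop)
    simp only [Prod.fst_swap, Prod.snd_swap] at e1 e2
    rw [e1, e2]
    exact add_le_add hle hle
  have hfin2 : ∫⁻ w, (c w.1 + c w.2) ∂ν ≠ ∞ := by
    have e1 := lintegral_restrict_prod_swap (π := π) hS hsymm (f := fun w => c w.1) (by fun_prop)
    simp only [Prod.fst_swap] at e1
    rw [lintegral_add_left (by fun_prop), e1]
    exact ENNReal.add_ne_top.2 ⟨hdiag, hdiag⟩
  have hlt : ∀ᵐ w ∂ν, c (w.1.1, w.2.2) + c (w.2.1, w.1.2) < c w.1 + c w.2 := by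
    refine (ae_restrict_mem hS).mono fun w hw => ?_
    simp only [hc, enorm_sq_eq_ofReal_sq]
    rw [← ENNReal.ofReal_add (sq_nonneg _) (sq_nonneg _),
      ← ENNReal.ofReal_add (sq_nonneg _) (sq_nonneg _)]
    have hw' : (w.1.1 - w.2.1) * (w.1.2 - w.2.2) < 0 := hw
    refine (ENNReal.ofReal_lt_ofReal_iff_of_nonneg (by positivity)).2 ?_
    nlinarith
  have hν0 : ν = 0 := by
    by_contra hne
    refine absurd hle2 (not_le.2 (lintegral_strict_mono hne (by fun_prop) ?_ hlt))
    exact ne_top_of_le_ne_top hfin2 (lintegral_mono_ae (hlt.mono fun _ => le_of_lt))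
  have hzero : (π.prod π) S = 0 := Measure.restrict_eq_zero.1 hν0
  have hae : ∀ᵐ w ∂π.prod π, 0 ≤ (w.1.1 - w.2.1) * (w.1.2 - w.2.2) := by
    rw [ae_iff]; simpa only [not_le] using hzero
  exact Measure.ae_ae_of_ae_prod hae

/-! ### A large sieve inequality -/

/-- The one-sided Dirichlet kernel `∑_{0 ≤ j < n} exp (2πiju)` on the circle. -/
noncomputable def dirichletSum (n : ℕ) (u : UnitAddCircle) : ℂ :=
  ∑ j ∈ Finset.range n, fourier (j : ℤ) u

theorem continuous_dirichletSum (n : ℕ) : Continuous (dirichletSum n) :=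
  continuous_finsetSum _ fun j _ => (fourier (j : ℤ)).continuous

theorem norm_fourier_apply (k : ℤ) (u : UnitAddCircle) : ‖fourier k u‖ = 1 := by
  rw [fourier_apply]; exact Circle.norm_coe _

theorem fourier_sub_apply (k : ℤ) (u v : UnitAddCircle) :
    fourier k (u - v) = fourier k u * (starRingEnd ℂ) (fourier k v) := by
  rw [← fourier_neg, fourier_apply, fourier_apply, fourier_apply, zsmul_sub, sub_eq_add_neg,
    AddCircle.toCircle_add, Circle.coe_mul, neg_zsmul]

theorem norm_dirichletSum_le (n : ℕ) (u : UnitAddCircle) : ‖dirichletSum n u‖ ≤ n := by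
  refine (norm_sum_le _ _).trans ?_
  simp only [norm_fourier_apply, Finset.sum_const, Finset.card_range, nsmul_eq_mul, mul_one,
    le_refl]

/-- The chord from `1` to `exp (2πiu)` has length `2 |sin (πu)|`, and `|sin (πu)| ≥ 2 |u|` for
`|u| ≤ 1 / 2`. -/
theorem four_mul_norm_le_norm_fourier_one_sub_one (u : UnitAddCircle) :
    4 * ‖u‖ ≤ ‖fourier 1 u - 1‖ := by
  induction u using QuotientAddGroup.induction_on with | H x => ?_
  have hx : (x : UnitAddCircle) = ((x - round x : ℝ) : UnitAddCircle) := by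
    rw [AddCircle.coe_sub, eq_comm, sub_eq_self]
    exact AddCircle.coe_eq_zero_iff 1 |>.2 ⟨round x, by simp⟩
  have hv := abs_sub_round x
  change 4 * ‖(x : UnitAddCircle)‖ ≤ ‖fourier 1 (x : UnitAddCircle) - 1‖
  rw [UnitAddCircle.norm_eq, hx, fourier_coe_apply]
  set v := x - round x
  have h1 : Complex.exp (2 * Real.pi * Complex.I * (1 : ℤ) * v / (1 : ℝ)) - 1
      = Complex.exp (Complex.I * ((2 * Real.pi * v : ℝ) : ℂ)) - 1 := by
    congr 2; push_cast; ring
  rw [h1, Complex.norm_exp_I_mul_ofReal_sub_one, Real.norm_eq_abs, abs_mul, abs_two]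
  have hpi := Real.pi_pos
  have h2 : 2 / Real.pi * |Real.pi * v| ≤ |Real.sin (Real.pi * v)| := by
    refine Real.mul_abs_le_abs_sin ?_
    rw [abs_mul, abs_of_pos hpi]
    nlinarith
  have h3 : 2 / Real.pi * |Real.pi * v| = 2 * |v| := by
    rw [abs_mul, abs_of_pos hpi]
    field_simp
  rw [show 2 * Real.pi * v / 2 = Real.pi * v by ring]
  linarith

/-- The decay of the Dirichlet kernel, from the geometric sum. -/
theorem norm_dirichletSum_mul_le (n : ℕ) (u : UnitAddCircle) :
    ‖dirichletSum n u‖ * (2 * ‖u‖) ≤ 1 := by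
  have hpow : ∀ j : ℕ, (fourier (j : ℤ) u : ℂ) = fourier 1 u ^ j := by
    intro j
    induction j with
    | zero => simp
    | succ j ih => rw [Nat.cast_succ, fourier_add, ih, pow_succ]
  have h : dirichletSum n u * (fourier 1 u - 1) = fourier (n : ℤ) u - 1 := by
    simp only [dirichletSum, hpow, geom_sum_mul]
  have h2 : ‖dirichletSum n u‖ * ‖fourier 1 u - 1‖ ≤ 2 := by
    rw [← norm_mul, h]
    refine (norm_sub_le _ _).trans ?_
    rw [norm_fourier_apply, norm_one]; norm_num
  have h3 := mul_le_mul_of_nonneg_left (four_mul_norm_le_norm_fourier_one_sub_one u)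
    (norm_nonneg (dirichletSum n u))
  linarith

/-- A dyadic majorant of the squared Dirichlet kernel: only the first shell containing `u` is
used. -/
theorem enorm_dirichletSum_sq_le {n : ℕ} (hn : 0 < n) (u : UnitAddCircle) :
    ‖dirichletSum n u‖ₑ ^ 2 ≤ ∑' i : ℕ, {v : UnitAddCircle | ‖v‖ < 2 ^ i / n}.indicator
      (fun _ => ENNReal.ofReal ((n / 2 ^ i) ^ 2)) u := by
  have hn' : (0 : ℝ) < n := by exact_mod_cast hn
  have hex : ∃ i : ℕ, ‖u‖ < 2 ^ i / n := by
    obtain ⟨i, hi⟩ := pow_unbounded_of_one_lt (‖u‖ * n) one_lt_two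
    exact ⟨i, (lt_div_iff₀ hn').2 hi⟩
  classical
  refine le_trans ?_ (ENNReal.le_tsum (Nat.find hex))
  rw [Set.indicator_of_mem (show u ∈ {v : UnitAddCircle | ‖v‖ < 2 ^ Nat.find hex / n} from
    Nat.find_spec hex), ← ofReal_norm, ← ENNReal.ofReal_pow (norm_nonneg _)]
  refine ENNReal.ofReal_le_ofReal (pow_le_pow_left₀ (norm_nonneg _) ?_ 2)
  rcases hi : Nat.find hex with _ | i
  · simpa using norm_dirichletSum_le n u
  · have hmin : ¬ ‖u‖ < 2 ^ i / n := Nat.find_min hex (by omega)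
    rw [not_lt, div_le_iff₀ hn'] at hmin
    have h1 := norm_dirichletSum_mul_le n u
    rw [le_div_iff₀ (by positivity), pow_succ]
    calc ‖dirichletSum n u‖ * (2 ^ i * 2) ≤ ‖dirichletSum n u‖ * (‖u‖ * n * 2) := by gcongr
      _ = ‖dirichletSum n u‖ * (2 * ‖u‖) * n := by ring
      _ ≤ 1 * n := by gcongr
      _ = n := one_mul _

/-- The image of `P` under `z` gives mass at most `K r ^ α` to every ball of radius `r`, with no
restriction on the centre or the radius. -/
def BallBound {Ω : Type*} [MeasurableSpace Ω] (P : Measure Ω) (z : Ω → UnitAddCircle)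
    (K : ℝ≥0∞) (α : ℝ) : Prop :=
  ∀ (c : UnitAddCircle) (r : ℝ), 0 < r → P {q | ‖c - z q‖ < r} ≤ K * ENNReal.ofReal (r ^ α)

theorem BallBound.lintegral_dirichletSum_sq_le {Ω : Type*} [MeasurableSpace Ω] {P : Measure Ω}
    {z : Ω → UnitAddCircle} (hz : Measurable z) {K : ℝ≥0∞} {α : ℝ} (hα : α ≤ 1)
    (hP : BallBound P z K α) {n : ℕ} (hn : 0 < n) (c : UnitAddCircle) :
    ∫⁻ q, ‖dirichletSum n (c - z q)‖ₑ ^ 2 ∂P ≤ 2 * K * ENNReal.ofReal ((n : ℝ) ^ (2 - α)) := by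
  have hn' : (0 : ℝ) < n := by exact_mod_cast hn
  have hset : ∀ ρ : ℝ, MeasurableSet {v : UnitAddCircle | ‖v‖ < ρ} := fun ρ =>
    (isOpen_lt continuous_norm continuous_const).measurableSet
  have hcz : Measurable fun q => c - z q := measurable_const.sub hz
  calc ∫⁻ q, ‖dirichletSum n (c - z q)‖ₑ ^ 2 ∂P
      ≤ ∫⁻ q, ∑' i : ℕ, {v : UnitAddCircle | ‖v‖ < 2 ^ i / n}.indicator
          (fun _ => ENNReal.ofReal ((n / 2 ^ i) ^ 2)) (c - z q) ∂P :=
        lintegral_mono fun q => enorm_dirichletSum_sq_le hn _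
    _ = ∑' i : ℕ, ∫⁻ q, {v : UnitAddCircle | ‖v‖ < 2 ^ i / n}.indicator
          (fun _ => ENNReal.ofReal ((n / 2 ^ i) ^ 2)) (c - z q) ∂P :=
        lintegral_tsum fun i => ((measurable_const.indicator (hset _)).comp hcz).aemeasurable
    _ = ∑' i : ℕ, ENNReal.ofReal ((n / 2 ^ i) ^ 2) * P {q | ‖c - z q‖ < 2 ^ i / n} := by
        refine tsum_congr fun i => ?_
        exact lintegral_indicator_const (hcz (hset (2 ^ i / n))) _
    _ ≤ ∑' i : ℕ, K * ENNReal.ofReal ((n : ℝ) ^ (2 - α)) * (2⁻¹) ^ i := by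
        refine ENNReal.tsum_le_tsum fun i => ?_
        refine (mul_le_mul_right (hP c _ (by positivity)) _).trans ?_
        rw [mul_left_comm, mul_assoc]
        refine mul_le_mul_right ?_ _
        have h2 : ((2 : ℝ≥0∞)⁻¹) ^ i = ENNReal.ofReal ((2⁻¹) ^ i) := by
          rw [ENNReal.ofReal_pow (by positivity), ENNReal.ofReal_inv_of_pos two_pos]; simp
        rw [h2, ← ENNReal.ofReal_mul (by positivity), ← ENNReal.ofReal_mul (by positivity)]
        refine ENNReal.ofReal_le_ofReal ?_
        have h2i : ((2 : ℝ) ^ i) ^ α ≤ 2 ^ i := by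
          conv_rhs => rw [← Real.rpow_one ((2 : ℝ) ^ i)]
          exact Real.rpow_le_rpow_of_exponent_le (one_le_pow₀ one_le_two) hα
        rw [Real.div_rpow (by positivity) hn'.le, Real.rpow_sub hn', Real.rpow_two, div_pow,
          inv_pow]
        have e : ((n : ℝ) ^ 2 / (2 ^ i) ^ 2 * (((2 : ℝ) ^ i) ^ α / (n : ℝ) ^ α))
          = (n : ℝ) ^ 2 / (n : ℝ) ^ α * (((2 : ℝ) ^ i) ^ α / (2 ^ i) ^ 2) := by ring
        rw [e]
        refine mul_le_mul_of_nonneg_left ?_ (by positivity)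
        rw [div_le_iff₀ (by positivity)]
        refine h2i.trans_eq ?_
        field_simp
    _ = 2 * K * ENNReal.ofReal ((n : ℝ) ^ (2 - α)) := by
        rw [ENNReal.tsum_mul_left, ENNReal.tsum_geometric, ENNReal.one_sub_inv_two, inv_inv]
        ring

theorem enorm_dirichletSum_neg (n : ℕ) (u : UnitAddCircle) :
    ‖dirichletSum n (-u)‖ₑ = ‖dirichletSum n u‖ₑ := by
  have : dirichletSum n (-u) = (starRingEnd ℂ) (dirichletSum n u) := by
    rw [dirichletSum, dirichletSum, map_sum]
    refine Finset.sum_congr rfl fun j _ => ?_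
    rw [← fourier_neg, fourier_apply, fourier_apply, smul_neg, neg_smul]
  rw [this, RCLike.enorm_conj]

/-- Schur's test for a symmetric kernel, with a crude constant. -/
theorem lintegral_prod_mul_le_of_symm {Ω : Type*} [MeasurableSpace Ω] {P : Measure Ω} [SFinite P]
    {k : Ω × Ω → ℝ≥0∞} (hk : Measurable k) (hsymm : ∀ p q, k (q, p) = k (p, q)) {L : ℝ≥0∞}
    (hL : ∀ p, ∫⁻ q, k (p, q) ∂P ≤ L) {g : Ω → ℝ≥0∞} (hg : Measurable g) :
    ∫⁻ w, k w * (g w.1 * g w.2) ∂P.prod P ≤ 2 * (L * ∫⁻ p, g p ^ 2 ∂P) := by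
  have h1 : ∫⁻ w, k w * g w.1 ^ 2 ∂P.prod P ≤ L * ∫⁻ p, g p ^ 2 ∂P := by
    rw [lintegral_prod _ (by fun_prop), ← lintegral_const_mul _ (by fun_prop)]
    refine lintegral_mono fun p => ?_
    calc ∫⁻ q, k (p, q) * g p ^ 2 ∂P = (∫⁻ q, k (p, q) ∂P) * g p ^ 2 :=
          lintegral_mul_const _ (by fun_prop)
      _ ≤ L * g p ^ 2 := mul_le_mul_left (hL p) _
  have h2 : ∫⁻ w, k w * g w.2 ^ 2 ∂P.prod P ≤ L * ∫⁻ p, g p ^ 2 ∂P := by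
    refine le_of_eq_of_le ?_ h1
    rw [← lintegral_prod_swap]
    refine lintegral_congr fun w => ?_
    rw [← hsymm w.1 w.2]
    rfl
  have hmul : ∀ a b : ℝ≥0∞, a * b ≤ a ^ 2 + b ^ 2 := by
    intro a b
    rcases le_total a b with h | h
    · exact (mul_le_mul_left h b).trans ((sq b).symm.le.trans le_add_self)
    · exact (mul_le_mul_right h a).trans ((sq a).symm.le.trans le_self_add)
  calc ∫⁻ w, k w * (g w.1 * g w.2) ∂P.prod P
      ≤ ∫⁻ w, (k w * g w.1 ^ 2 + k w * g w.2 ^ 2) ∂P.prod P := by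
        refine lintegral_mono fun w => ?_
        rw [← mul_add]
        exact mul_le_mul_right (hmul _ _) _
    _ ≤ 2 * (L * ∫⁻ p, g p ^ 2 ∂P) := by
        rw [lintegral_add_left (by fun_prop), two_mul]
        exact add_le_add h1 h2

/-- Expanding the squares turns the sum of `|∫ exp (2πi(j-l)z) g|²` over `0 ≤ j, l < n` into a
quadratic form with the nonnegative kernel `|dirichletSum n|²`, which Schur's test bounds. -/
theorem sum_sum_enorm_integral_fourier_sq_le {Ω : Type*} [MeasurableSpace Ω] {P : Measure Ω}
    [IsFiniteMeasure P] {z : Ω → UnitAddCircle} (hz : Measurable z) {g : Ω → ℝ}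
    (hgm : Measurable g) (hg : Integrable g P) {L : ℝ≥0∞} {n : ℕ}
    (hL : ∀ c, ∫⁻ q, ‖dirichletSum n (c - z q)‖ₑ ^ 2 ∂P ≤ L) :
    ∑ j ∈ Finset.range n, ∑ l ∈ Finset.range n,
        ‖∫ p, fourier ((j : ℤ) - l) (z p) * (g p : ℂ) ∂P‖ₑ ^ 2 ≤ 2 * (L * ∫⁻ p, ‖g p‖ₑ ^ 2 ∂P) := by
  set A : ℤ → ℂ := fun k => ∫ p, fourier k (z p) * (g p : ℂ) ∂P with hA
  have hint : ∀ k : ℤ, Integrable (fun p => fourier k (z p) * (g p : ℂ)) P := fun k =>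
    hg.ofReal.bdd_mul (c := 1) ((fourier k).continuous.measurable.comp hz).aestronglyMeasurable
      (.of_forall fun p => (norm_fourier_apply _ _).le)
  have hint2 : ∀ k : ℤ, Integrable (fun w : Ω × Ω =>
      fourier k (z w.1 - z w.2) * ((g w.1 * g w.2 : ℝ) : ℂ)) (P.prod P) := by
    intro k
    refine ((hg.mul_prod hg).ofReal (𝕜 := ℂ)).bdd_mul (c := 1) ?_
      (.of_forall fun p => (norm_fourier_apply _ _).le)
    exact ((fourier k).continuous.measurable.comp
      ((hz.comp measurable_fst).sub (hz.comp measurable_snd))).aestronglyMeasurable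
  have hAsq : ∀ k : ℤ, ((‖A k‖ ^ 2 : ℝ) : ℂ)
      = ∫ w, fourier k (z w.1 - z w.2) * ((g w.1 * g w.2 : ℝ) : ℂ) ∂P.prod P := by
    intro k
    rw [Complex.ofReal_pow, ← Complex.mul_conj', hA, ← integral_conj, ← integral_prod_mul]
    refine integral_congr_ae (.of_forall fun w => ?_)
    simp only [fourier_sub_apply, map_mul, Complex.conj_ofReal, Complex.ofReal_mul]
    ring
  have hker : ∀ u : UnitAddCircle, ∑ j ∈ Finset.range n, ∑ l ∈ Finset.range n,
      (fourier ((j : ℤ) - l) u : ℂ) = ((‖dirichletSum n u‖ ^ 2 : ℝ) : ℂ) := by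
    intro u
    rw [Complex.ofReal_pow, ← Complex.mul_conj', dirichletSum, map_sum, Finset.sum_mul_sum]
    simp only [← fourier_neg, ← fourier_add, sub_eq_add_neg]
  have hsum : ((∑ j ∈ Finset.range n, ∑ l ∈ Finset.range n, ‖A ((j : ℤ) - l)‖ ^ 2 : ℝ) : ℂ)
      = ∫ w, ((‖dirichletSum n (z w.1 - z w.2)‖ ^ 2 : ℝ) : ℂ) * ((g w.1 * g w.2 : ℝ) : ℂ)
        ∂P.prod P := by
    simp only [Complex.ofReal_sum, hAsq]
    simp_rw [← integral_finsetSum _ fun _ _ => hint2 _]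
    rw [← integral_finsetSum _ fun _ _ => integrable_finsetSum _ fun _ _ => hint2 _]
    simp_rw [← Finset.sum_mul, hker]
  calc ∑ j ∈ Finset.range n, ∑ l ∈ Finset.range n, ‖A ((j : ℤ) - l)‖ₑ ^ 2
      = ‖((∑ j ∈ Finset.range n, ∑ l ∈ Finset.range n, ‖A ((j : ℤ) - l)‖ ^ 2 : ℝ) : ℂ)‖ₑ := by
        rw [← ofReal_norm, Complex.norm_real, Real.norm_of_nonneg (by positivity),
          ENNReal.ofReal_sum_of_nonneg fun _ _ => by positivity]
        refine Finset.sum_congr rfl fun j _ => ?_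
        rw [ENNReal.ofReal_sum_of_nonneg fun _ _ => by positivity]
        refine Finset.sum_congr rfl fun l _ => ?_
        rw [ENNReal.ofReal_pow (norm_nonneg _), ofReal_norm]
    _ ≤ ∫⁻ w, ‖dirichletSum n (z w.1 - z w.2)‖ₑ ^ 2 * (‖g w.1‖ₑ * ‖g w.2‖ₑ) ∂P.prod P := by
        rw [hsum]
        refine (enorm_integral_le_lintegral_enorm _).trans_eq (lintegral_congr fun w => ?_)
        rw [enorm_mul, ← ofReal_norm, Complex.norm_real, Real.norm_of_nonneg (by positivity),
          ENNReal.ofReal_pow (norm_nonneg _), ofReal_norm, ← ofReal_norm (Complex.ofReal _),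
          Complex.norm_real, ofReal_norm, enorm_mul]
    _ ≤ 2 * (L * ∫⁻ p, ‖g p‖ₑ ^ 2 ∂P) := by
        refine lintegral_prod_mul_le_of_symm (k := fun w => ‖dirichletSum n (z w.1 - z w.2)‖ₑ ^ 2)
          ?_ (fun p q => ?_) (fun p => hL (z p)) hgm.enorm
        · exact (((continuous_dirichletSum n).measurable.comp
            ((hz.comp measurable_fst).sub (hz.comp measurable_snd))).enorm).pow_const 2
        · simp only
          rw [← neg_sub (z p), enorm_dirichletSum_neg]

/-- Every difference `k` with `|k| ≤ N` is attained by at least `N` pairs in `[0, 3N)²`. -/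
theorem mul_sum_Icc_le_sum_range_sub (N : ℕ) (f : ℤ → ℝ≥0∞) :
    N * ∑ k ∈ Finset.Icc (-(N : ℤ)) N, f k ≤
      ∑ j ∈ Finset.range (3 * N), ∑ l ∈ Finset.range (3 * N), f ((j : ℤ) - l) := by
  rw [Finset.sum_comm]
  calc (N : ℝ≥0∞) * ∑ k ∈ Finset.Icc (-(N : ℤ)) N, f k
      = ∑ l ∈ Finset.Ico N (2 * N), ∑ k ∈ Finset.Icc (-(N : ℤ)) N, f k := by
        rw [Finset.sum_const, Nat.card_Ico, nsmul_eq_mul]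
        congr 2; omega
    _ ≤ ∑ l ∈ Finset.Ico N (2 * N), ∑ j ∈ Finset.range (3 * N), f ((j : ℤ) - l) := by
        refine Finset.sum_le_sum fun l hl => ?_
        rw [Finset.mem_Ico] at hl
        -- For `l` in the middle third the point `k + l` stays in `[0, 3N)`.
        have hinj : Set.InjOn (fun k : ℤ => (k + l).toNat) (Finset.Icc (-(N : ℤ)) N) := by
          intro a ha b hb hab
          simp only [Finset.coe_Icc, Set.mem_Icc] at ha hb hab
          omega
        have heq : ∑ k ∈ Finset.Icc (-(N : ℤ)) N, f k
            = ∑ j ∈ (Finset.Icc (-(N : ℤ)) N).image fun k : ℤ => (k + l).toNat,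
              f ((j : ℤ) - l) := by
          rw [Finset.sum_image hinj]
          refine Finset.sum_congr rfl fun k hk => ?_
          rw [Finset.mem_Icc] at hk
          congr 1; omega
        rw [heq]
        refine Finset.sum_le_sum_of_subset fun j hj => ?_
        obtain ⟨k, hk, rfl⟩ := Finset.mem_image.1 hj
        rw [Finset.mem_Icc] at hk
        rw [Finset.mem_range]; omega
    _ ≤ _ := Finset.sum_le_sum_of_subset fun l hl => by
        rw [Finset.mem_Ico] at hl; rw [Finset.mem_range]; omega

/-- A large sieve inequality for measures with a ball bound. -/
theorem BallBound.sum_enorm_integral_fourier_sq_le {Ω : Type*} [MeasurableSpace Ω] {P : Measure Ω}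
    [IsFiniteMeasure P] {z : Ω → UnitAddCircle} (hz : Measurable z) {K : ℝ≥0∞} {α : ℝ}
    (hα : α ∈ Set.Icc (0 : ℝ) 1) (hP : BallBound P z K α) {g : Ω → ℝ} (hgm : Measurable g)
    (hg : Integrable g P) {N : ℕ} (hN : 0 < N) :
    ∑ k ∈ Finset.Icc (-(N : ℤ)) N, ‖∫ p, fourier k (z p) * (g p : ℂ) ∂P‖ₑ ^ 2
      ≤ 36 * K * ENNReal.ofReal ((N : ℝ) ^ (1 - α)) * ∫⁻ p, ‖g p‖ₑ ^ 2 ∂P := by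
  have hN' : (0 : ℝ) < N := by exact_mod_cast hN
  have h := (mul_sum_Icc_le_sum_range_sub N
    fun k => ‖∫ p, fourier k (z p) * (g p : ℂ) ∂P‖ₑ ^ 2).trans
    (sum_sum_enorm_integral_fourier_sq_le hz hgm hg
      fun c => hP.lintegral_dirichletSum_sq_le hz hα.2 (by omega) c)
  refine (ENNReal.mul_le_mul_iff_right (a := (N : ℝ≥0∞)) (by simpa using hN.ne')
    (ENNReal.natCast_ne_top N)).1 (h.trans ?_)
  set G := ∫⁻ p, ‖g p‖ₑ ^ 2 ∂P
  have h3 : ENNReal.ofReal (((3 * N : ℕ) : ℝ) ^ (2 - α))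
      ≤ 9 * (N * ENNReal.ofReal ((N : ℝ) ^ (1 - α))) := by
    rw [← ENNReal.ofReal_natCast N, ← ENNReal.ofReal_ofNat 9, ← ENNReal.ofReal_mul hN'.le,
      ← ENNReal.ofReal_mul (by norm_num)]
    refine ENNReal.ofReal_le_ofReal ?_
    rw [Nat.cast_mul, Real.mul_rpow (by norm_num) hN'.le]
    have e : (N : ℝ) ^ (2 - α) = N * (N : ℝ) ^ (1 - α) := by
      rw [show (2 - α) = 1 + (1 - α) by ring, Real.rpow_add hN', Real.rpow_one]
    rw [e]
    refine mul_le_mul_of_nonneg_right ?_ (by positivity)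
    calc ((3 : ℕ) : ℝ) ^ (2 - α) ≤ ((3 : ℕ) : ℝ) ^ (2 : ℝ) :=
          Real.rpow_le_rpow_of_exponent_le (by norm_num) (by linarith [hα.1])
      _ = 9 := by norm_num
  calc 2 * (2 * K * ENNReal.ofReal (((3 * N : ℕ) : ℝ) ^ (2 - α)) * G)
      ≤ 2 * (2 * K * (9 * (N * ENNReal.ofReal ((N : ℝ) ^ (1 - α)))) * G) := by gcongr
    _ = N * (36 * K * ENNReal.ofReal ((N : ℝ) ^ (1 - α)) * G) := by ring

/-! ### Ahlfors regularity along the interpolation -/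

/-- Upper Ahlfors regularity controls the balls around all points, at all scales: a ball that is
not null contains a point of the support, and is contained in the ball of twice its radius around
that point. -/
theorem UpperAhlforsRegular.exists_measure_ball_le {α : ℝ} (hα : α ∈ Set.Icc (0 : ℝ) 1)
    {μ : Measure UnitAddCircle} [IsProbabilityMeasure μ] (hμ : UpperAhlforsRegular α μ) :
    ∃ M : ℝ≥0∞, M ≠ ∞ ∧ ∀ x r, 0 < r → μ (Metric.ball x r) ≤ M * ENNReal.ofReal (r ^ α) := by
  obtain ⟨M, hM, h⟩ := hμ
  refine ⟨ENNReal.ofReal (2 * max M 1), ENNReal.ofReal_ne_top, fun x r hr => ?_⟩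
  rw [← ENNReal.ofReal_mul (by positivity)]
  rcases (zero_le : 0 ≤ μ (Metric.ball x r)).eq_or_lt with h0 | hpos
  · rw [← h0]; exact zero_le
  obtain ⟨y, hy, hys⟩ := Measure.nonempty_inter_support_of_pos hpos
  have hsub : Metric.ball x r ⊆ Metric.ball y (2 * r) := by
    intro w hw
    rw [Metric.mem_ball] at *
    linarith [dist_triangle_right w y x]
  rcases le_total (2 * r) 1 with h1 | h1
  · refine ((measure_mono hsub).trans (h y hys _ ⟨by positivity, h1⟩)).trans
      (ENNReal.ofReal_le_ofReal ?_)
    have h2 : (2 : ℝ) ^ α ≤ 2 := by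
      conv_rhs => rw [← Real.rpow_one 2]
      exact Real.rpow_le_rpow_of_exponent_le one_le_two hα.2
    rw [Real.mul_rpow zero_le_two hr.le, ← mul_assoc, mul_comm 2 (max M 1)]
    gcongr
    exact le_max_left _ _
  · refine prob_le_one.trans ?_
    rw [ENNReal.one_le_ofReal]
    have h2 : (2 : ℝ)⁻¹ ≤ r ^ α := by
      calc (2 : ℝ)⁻¹ = 2⁻¹ ^ (1 : ℝ) := (Real.rpow_one _).symm
        _ ≤ 2⁻¹ ^ α := Real.rpow_le_rpow_of_exponent_ge (by norm_num) (by norm_num) hα.2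
        _ ≤ r ^ α := Real.rpow_le_rpow (by norm_num) (by linarith) hα.1
    nlinarith [le_max_right M 1]

/-- Along a monotone plan the map `(x, y) ↦ (1 - τ) x + τ y` expands `x`-distances by a factor at
least `1 - τ`, so that the interpolants inherit the ball bound of the first marginal. -/
theorem measure_interpolant_interval_le {π : Measure (ℝ × ℝ)} {μ : Measure UnitAddCircle}
    (hfst : π.map (fun p => (p.1 : UnitAddCircle)) = μ)
    (hmono : ∀ᵐ p ∂π, ∀ᵐ q ∂π, 0 ≤ (p.1 - q.1) * (p.2 - q.2)) {M : ℝ≥0∞} {α : ℝ}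
    (hM : ∀ x r, 0 < r → μ (Metric.ball x r) ≤ M * ENNReal.ofReal (r ^ α)) {lam τ : ℝ}
    (hlam : lam < 1) (hτ : τ ∈ Set.Icc 0 lam) (c : ℝ) {r : ℝ} (hr : 0 < r) :
    π {p | |c - ((1 - τ) * p.1 + τ * p.2)| < r}
      ≤ M * ENNReal.ofReal ((4 / (1 - lam) * r) ^ α) := by
  set E := {p : ℝ × ℝ | |c - ((1 - τ) * p.1 + τ * p.2)| < r}
  by_cases h0 : π E = 0
  · rw [h0]; exact zero_le
  have hlam' : 0 < 1 - lam := by linarith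
  obtain ⟨p, hpE, hp⟩ : ∃ p ∈ E, ∀ᵐ q ∂π, 0 ≤ (p.1 - q.1) * (p.2 - q.2) := by
    -- A set of positive measure contains one of the almost all good centres.
    by_contra hcon
    exact h0 (measure_mono_null (fun p hp h => hcon ⟨p, hp, h⟩) (ae_iff.1 hmono))
  have hmeas : Measurable fun q : ℝ × ℝ => (q.1 : UnitAddCircle) :=
    (AddCircle.continuous_mk' 1).measurable.comp measurable_fst
  refine le_trans ?_ (hM (p.1 : UnitAddCircle) (4 / (1 - lam) * r) (by positivity))
  rw [← hfst, Measure.map_apply hmeas Metric.isOpen_ball.measurableSet]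
  refine measure_mono_ae ?_
  filter_upwards [hp] with q hq hqE
  have hqE' : |c - ((1 - τ) * q.1 + τ * q.2)| < r := hqE
  have hpE' : |c - ((1 - τ) * p.1 + τ * p.2)| < r := hpE
  change (q.1 : UnitAddCircle) ∈ Metric.ball (p.1 : UnitAddCircle) _
  rw [Metric.mem_ball, dist_eq_norm, ← AddCircle.coe_sub]
  -- The norm on the circle is at most the absolute value on the line.
  have hnorm : ‖((q.1 - p.1 : ℝ) : UnitAddCircle)‖ ≤ |q.1 - p.1| := by
    rw [UnitAddCircle.norm_eq]
    simpa using round_le (q.1 - p.1) 0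
  refine hnorm.trans_lt ?_
  have hz : |(1 - τ) * (q.1 - p.1) + τ * (q.2 - p.2)| < 2 * r := by
    rw [abs_lt] at *; constructor <;> linarith [hqE'.1, hqE'.2, hpE'.1, hpE'.2]
  have hexp : (1 - τ) * |q.1 - p.1| ≤ |(1 - τ) * (q.1 - p.1) + τ * (q.2 - p.2)| := by
    have h1 : 0 ≤ 1 - τ := by linarith [hτ.2]
    rw [← abs_of_nonneg h1, ← abs_mul, abs_of_nonneg h1]
    refine sq_le_sq.1 ?_
    -- By monotonicity the cross term of the square on the right is nonnegative.
    have := mul_nonneg (mul_nonneg h1 hτ.1) hq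
    nlinarith [sq_nonneg (τ * (q.2 - p.2))]
  have hlt : (1 - lam) * |q.1 - p.1| < 2 * r := by
    refine (le_trans ?_ hexp).trans_lt hz
    gcongr; exact hτ.2
  rw [div_mul_eq_mul_div, lt_div_iff₀ hlam']
  linarith

/-- The point `(1 - τ) x + τ y` of the segment between the two points of a pair, on the circle. -/
def interpPoint (τ : ℝ) (p : ℝ × ℝ) : UnitAddCircle :=
  (((1 - τ) * p.1 + τ * p.2 : ℝ) : UnitAddCircle)

theorem continuous_interpPoint : Continuous fun w : (ℝ × ℝ) × ℝ => interpPoint w.2 w.1 :=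
  (AddCircle.continuous_mk' 1).comp (by fun_prop)

theorem measurable_interpPoint (τ : ℝ) : Measurable (interpPoint τ) :=
  (continuous_interpPoint.comp (Continuous.prodMk_left τ)).measurable

/-- A ball of the circle meets a period in at most three intervals of the line. -/
theorem ballBound_interpPoint {π : Measure (ℝ × ℝ)} {μ : Measure UnitAddCircle}
    (hfst : π.map (fun p => (p.1 : UnitAddCircle)) = μ)
    (hmono : ∀ᵐ p ∂π, ∀ᵐ q ∂π, 0 ≤ (p.1 - q.1) * (p.2 - q.2)) {M : ℝ≥0∞} {α : ℝ}
    (hM : ∀ x r, 0 < r → μ (Metric.ball x r) ≤ M * ENNReal.ofReal (r ^ α)) {a : ℝ}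
    (hper : ∀ᵐ p ∂π, p.1 ∈ Set.Icc a (a + 1) ∧ p.2 ∈ Set.Icc a (a + 1)) {lam τ : ℝ}
    (hlam : lam < 1) (hτ : τ ∈ Set.Icc 0 lam) :
    BallBound π (interpPoint τ) (3 * (M * ENNReal.ofReal ((4 / (1 - lam)) ^ α))) α := by
  intro c r hr
  obtain ⟨x, hx, rfl⟩ : c ∈ QuotientAddGroup.mk '' Set.Ico a (a + 1) := by
    rw [AddCircle.coe_image_Ico_eq 1 a]; trivial
  have hlam' : 0 < 1 - lam := by linarith
  let E : ℤ → Set (ℝ × ℝ) := fun m => {p | |(x - m) - ((1 - τ) * p.1 + τ * p.2)| < r}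
  have hEm : ∀ m, π (E m) ≤ M * ENNReal.ofReal ((4 / (1 - lam)) ^ α) * ENNReal.ofReal (r ^ α) := by
    intro m
    refine (measure_interpolant_interval_le hfst hmono hM hlam hτ (x - m) hr).trans_eq ?_
    rw [Real.mul_rpow (by positivity) hr.le, ENNReal.ofReal_mul (by positivity), mul_assoc]
  have hsub : {p | ‖(x : UnitAddCircle) - interpPoint τ p‖ < r} ≤ᵐ[π] ⋃ m ∈ Finset.Icc (-1 : ℤ) 1,
      E m := by
    filter_upwards [hper] with p ⟨hp1, hp2⟩ hp
    have hp' : ‖(x : UnitAddCircle) - interpPoint τ p‖ < r := hp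
    rw [interpPoint, ← AddCircle.coe_sub, UnitAddCircle.norm_eq] at hp'
    set u := x - ((1 - τ) * p.1 + τ * p.2) with hu
    have hz : (1 - τ) * p.1 + τ * p.2 ∈ Set.Icc a (a + 1) := by
      have h1 : 0 ≤ 1 - τ := by linarith [hτ.2]
      constructor
      · nlinarith [hp1.1, hp2.1, mul_le_mul_of_nonneg_left hp1.1 h1,
          mul_le_mul_of_nonneg_left hp2.1 hτ.1]
      · nlinarith [hp1.1, hp2.1, mul_le_mul_of_nonneg_left hp1.2 h1,
          mul_le_mul_of_nonneg_left hp2.2 hτ.1]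
    have hround := abs_le.1 (abs_sub_round u)
    have h1 : (round u : ℝ) < 2 := by linarith [hx.2, hz.1]
    have h2 : (-2 : ℝ) < round u := by linarith [hx.1, hz.2]
    have h1' : round u < 2 := by exact_mod_cast h1
    have h2' : -2 < round u := by exact_mod_cast h2
    refine Set.mem_biUnion (x := round u) (by simp only [Finset.coe_Icc, Set.mem_Icc]; omega) ?_
    change |(x - round u) - _| < r
    rwa [sub_right_comm]
  calc π {p | ‖(x : UnitAddCircle) - interpPoint τ p‖ < r}
      ≤ ∑ m ∈ Finset.Icc (-1 : ℤ) 1, π (E m) :=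
        (measure_mono_ae hsub).trans (measure_biUnion_finset_le _ _)
    _ ≤ ∑ m ∈ Finset.Icc (-1 : ℤ) 1,
          M * ENNReal.ofReal ((4 / (1 - lam)) ^ α) * ENNReal.ofReal (r ^ α) :=
        Finset.sum_le_sum fun m _ => hEm m
    _ = _ := by
        rw [Finset.sum_const, show (Finset.Icc (-1 : ℤ) 1).card = 3 from rfl, nsmul_eq_mul,
          mul_assoc 3, Nat.cast_ofNat]

/-! ### Fourier coefficients along the interpolation -/

/-- Grouping the frequencies into dyadic blocks, each estimated by the whole range below it. -/
theorem tsum_rpow_mul_le_dyadic {s : ℝ} (hs : s ∈ Set.Ioo (0 : ℝ) 1) {f : ℤ → ℝ≥0∞}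
    (hf : f 0 = 0) :
    ∑' k : ℤ, ‖(k : ℝ)‖ₑ ^ (-(2 * s)) * f k ≤
      4 * ∑' j : ℕ, ENNReal.ofReal (((2 : ℝ) ^ j) ^ (-(2 * s))) *
        ∑ k ∈ Finset.Icc (-((2 ^ j : ℕ) : ℤ)) (2 ^ j : ℕ), f k := by
  have hind : ∀ j : ℕ, ∑ k ∈ Finset.Icc (-((2 ^ j : ℕ) : ℤ)) (2 ^ j : ℕ), f k
      = ∑' k : ℤ, (Set.Icc (-((2 ^ j : ℕ) : ℤ)) (2 ^ j : ℕ)).indicator f k := by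
    intro j
    rw [← Finset.coe_Icc, ← tsum_subtype, Finset.tsum_subtype']
  simp_rw [hind, ← ENNReal.tsum_mul_left]
  rw [ENNReal.tsum_comm]
  refine ENNReal.tsum_le_tsum fun k => ?_
  rcases eq_or_ne k 0 with rfl | hk
  · -- The weight of the frequency `0` is `∞`, so this term needs `f 0 = 0`.
    rw [hf, mul_zero]; exact zero_le
  set m := k.natAbs with hm
  have hm0 : m ≠ 0 := Int.natAbs_ne_zero.2 hk
  have hmpos : (0 : ℝ) < m := by exact_mod_cast Nat.pos_of_ne_zero hm0
  set j := Nat.log 2 m + 1 with hj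
  have hlt : m < 2 ^ j := Nat.lt_pow_succ_log_self one_lt_two m
  have hle : 2 ^ j ≤ 2 * m := by
    rw [hj, pow_succ, mul_comm]
    exact Nat.mul_le_mul_left 2 (Nat.pow_log_le_self 2 hm0)
  have hle' : (2 : ℝ) ^ j ≤ 2 * m := by exact_mod_cast hle
  refine le_trans ?_ (ENNReal.le_tsum j)
  have hmem : k ∈ Set.Icc (-((2 ^ j : ℕ) : ℤ)) (2 ^ j : ℕ) := by
    rw [Set.mem_Icc]; omega
  rw [Set.indicator_of_mem hmem, ← mul_assoc]
  refine mul_le_mul_left ?_ _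
  have habs : |(k : ℝ)| = m := by rw [hm, Nat.cast_natAbs, Int.cast_abs]
  rw [Real.enorm_eq_ofReal_abs, habs, ENNReal.ofReal_rpow_of_pos hmpos,
    ← ENNReal.ofReal_ofNat 4, ← ENNReal.ofReal_mul (by norm_num)]
  refine ENNReal.ofReal_le_ofReal ?_
  have h1 : (2 * (m : ℝ)) ^ (-(2 * s)) ≤ ((2 : ℝ) ^ j) ^ (-(2 * s)) :=
    Real.rpow_le_rpow_of_nonpos (by positivity) hle' (by linarith [hs.1])
  have h2 : (4 : ℝ)⁻¹ ≤ 2 ^ (-(2 * s)) := by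
    calc (4 : ℝ)⁻¹ = 2 ^ (-2 : ℝ) := by rw [Real.rpow_neg zero_le_two]; norm_num
      _ ≤ 2 ^ (-(2 * s)) := Real.rpow_le_rpow_of_exponent_le one_le_two (by linarith [hs.2])
  rw [Real.mul_rpow zero_le_two hmpos.le] at h1
  have h3 : (0 : ℝ) ≤ (m : ℝ) ^ (-(2 * s)) := by positivity
  nlinarith [mul_le_mul_of_nonneg_right h2 h3]

theorem min_one_le_rpow {θ : ℝ} (hθ : θ ∈ Set.Icc (0 : ℝ) 1) (t : ℝ≥0∞) : min 1 t ≤ t ^ θ := by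
  rcases le_total t 1 with h | h
  · calc min 1 t ≤ t ^ (1 : ℝ) := by rw [ENNReal.rpow_one]; exact min_le_right _ _
      _ ≤ t ^ θ := ENNReal.rpow_le_rpow_of_exponent_ge h hθ.2
  · calc min 1 t ≤ 1 := min_le_left _ _
      _ = 1 ^ θ := (ENNReal.one_rpow _).symm
      _ ≤ t ^ θ := ENNReal.rpow_le_rpow h hθ.1

theorem integrable_fourier_comp {Ω : Type*} [MeasurableSpace Ω] {P : Measure Ω}
    [IsFiniteMeasure P] {z : Ω → UnitAddCircle} (hz : Measurable z) (k : ℤ) :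
    Integrable (fun p => (fourier k (z p) : ℂ)) P :=
  Integrable.of_bound ((fourier k).continuous.measurable.comp hz).aestronglyMeasurable 1
    (.of_forall fun _ => (norm_fourier_apply _ _).le)

/-- The fundamental theorem of calculus in `τ`, integrated over the plan: the difference of the
Fourier coefficients of two interpolants is a single Fourier coefficient of the displacement with
respect to the space-time measure `π ⊗ dτ`. -/
theorem integral_sub_eq_integral_prod {π : Measure (ℝ × ℝ)} [IsFiniteMeasure π]
    (hint : Integrable (fun p : ℝ × ℝ => p.2 - p.1) π) {lam : ℝ} (hlam : 0 ≤ lam) (k : ℤ) :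
    ∫ p, (fourier k (interpPoint lam p) : ℂ) ∂π - ∫ p, (fourier k (interpPoint 0 p) : ℂ) ∂π =
      2 * Real.pi * Complex.I * k * ∫ w, fourier k (interpPoint w.2 w.1) *
        ((w.1.2 - w.1.1 : ℝ) : ℂ) ∂π.prod (volume.restrict (Set.Ioc 0 lam)) := by
  have hcont : Continuous fun w : (ℝ × ℝ) × ℝ => (fourier k (interpPoint w.2 w.1) : ℂ) :=
    (fourier k).continuous.comp continuous_interpPoint
  have hI : Integrable (fun w : (ℝ × ℝ) × ℝ => (fourier k (interpPoint w.2 w.1) : ℂ) *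
      ((w.1.2 - w.1.1 : ℝ) : ℂ)) (π.prod (volume.restrict (Set.Ioc 0 lam))) :=
    (hint.comp_fst _).ofReal.bdd_mul (c := 1) hcont.aestronglyMeasurable
      (.of_forall fun _ => (norm_fourier_apply _ _).le)
  rw [← integral_sub (integrable_fourier_comp (measurable_interpPoint _) k)
    (integrable_fourier_comp (measurable_interpPoint _) k), integral_prod _ hI,
    ← integral_const_mul]
  refine integral_congr_ae (.of_forall fun p => ?_)
  simp only
  rw [← integral_const_mul, ← intervalIntegral.integral_of_le hlam]
  symm
  refine intervalIntegral.integral_eq_sub_of_hasDerivAt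
    (f := fun τ => (fourier k (interpPoint τ p) : ℂ)) (fun τ _ => ?_) ?_
  · have h1 := hasDerivAt_fourier 1 k ((1 - τ) * p.1 + τ * p.2)
    have h2 : HasDerivAt (fun τ : ℝ => (1 - τ) * p.1 + τ * p.2) (p.2 - p.1) τ := by
      exact ((((hasDerivAt_id τ).const_sub 1).mul_const p.1).add
        ((hasDerivAt_id τ).mul_const p.2)).congr_deriv (by ring)
    refine (h1.scomp τ h2).congr_deriv ?_
    rw [Complex.real_smul, interpPoint, Complex.ofReal_one, div_one]
    ring
  · refine Continuous.intervalIntegrable ?_ _ _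
    exact continuous_const.mul ((hcont.comp (Continuous.prodMk_right p)).mul continuous_const)

theorem BallBound.prod {π : Measure (ℝ × ℝ)} [IsFiniteMeasure π] {K : ℝ≥0∞} {α lam : ℝ}
    (hlam : lam ≤ 1) (hB : ∀ τ ∈ Set.Icc 0 lam, BallBound π (interpPoint τ) K α) :
    BallBound (π.prod (volume.restrict (Set.Ioc 0 lam))) (fun w => interpPoint w.2 w.1) K α := by
  intro c r hr
  have hm : MeasurableSet {w : (ℝ × ℝ) × ℝ | ‖c - interpPoint w.2 w.1‖ < r} :=
    (isOpen_lt (continuous_const.sub continuous_interpPoint).norm continuous_const).measurableSet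
  rw [Measure.prod_apply_symm hm]
  calc ∫⁻ τ in Set.Ioc 0 lam, π ((fun p => (p, τ)) ⁻¹' {w | ‖c - interpPoint w.2 w.1‖ < r})
      ≤ ∫⁻ _ in Set.Ioc 0 lam, K * ENNReal.ofReal (r ^ α) :=
        setLIntegral_mono measurable_const fun τ hτ => hB τ ⟨hτ.1.le, hτ.2⟩ c r hr
    _ = K * ENNReal.ofReal (r ^ α) * ENNReal.ofReal lam := by
        rw [setLIntegral_const, Real.volume_Ioc, sub_zero]
    _ ≤ K * ENNReal.ofReal (r ^ α) := mul_le_of_le_one_right' (ENNReal.ofReal_le_one.2 hlam)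

theorem enorm_sub_sq_le (a b : ℂ) : ‖a - b‖ₑ ^ 2 ≤ 2 * ‖a‖ₑ ^ 2 + 2 * ‖b‖ₑ ^ 2 := by
  rw [← ofReal_norm, ← ofReal_norm, ← ofReal_norm, ← ENNReal.ofReal_pow (norm_nonneg _),
    ← ENNReal.ofReal_pow (norm_nonneg _), ← ENNReal.ofReal_pow (norm_nonneg _),
    ← ENNReal.ofReal_ofNat 2, ← ENNReal.ofReal_mul zero_le_two, ← ENNReal.ofReal_mul zero_le_two,
    ← ENNReal.ofReal_add (by positivity) (by positivity)]
  refine ENNReal.ofReal_le_ofReal ?_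
  nlinarith [norm_sub_le a b, norm_nonneg (a - b), sq_nonneg (‖a‖ - ‖b‖)]

/-- The frequencies up to `N` of the difference of the end points of a displacement interpolation.
The first bound comes from the large sieve for the two end points, with `g = 1`; the second from the
large sieve for the space-time measure `π ⊗ dτ` with `g` the displacement. -/
theorem sum_enorm_fourier_sub_sq_le {π : Measure (ℝ × ℝ)} [IsProbabilityMeasure π]
    (hint : Integrable (fun p : ℝ × ℝ => p.2 - p.1) π) {K : ℝ≥0∞} {α lam : ℝ}
    (hα : α ∈ Set.Icc (0 : ℝ) 1) (hlam : lam ∈ Set.Icc (0 : ℝ) 1)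
    (hB : ∀ τ ∈ Set.Icc 0 lam, BallBound π (interpPoint τ) K α) {N : ℕ} (hN : 0 < N) :
    ∑ k ∈ Finset.Icc (-(N : ℤ)) N, ‖∫ p, (fourier k (interpPoint lam p) : ℂ) ∂π -
        ∫ p, (fourier k (interpPoint 0 p) : ℂ) ∂π‖ₑ ^ 2
      ≤ 1440 * K * ENNReal.ofReal ((N : ℝ) ^ (1 - α)) *
        min 1 (ENNReal.ofReal ((N : ℝ) ^ 2) * transportCost π) := by
  set X := K * ENNReal.ofReal ((N : ℝ) ^ (1 - α)) with hX
  rw [mul_min, mul_one]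
  refine le_min ?_ ?_
  · have hone : ∀ τ ∈ Set.Icc 0 lam, ∑ k ∈ Finset.Icc (-(N : ℤ)) N,
        ‖∫ p, (fourier k (interpPoint τ p) : ℂ) ∂π‖ₑ ^ 2 ≤ 36 * X := by
      intro τ hτ
      have := (hB τ hτ).sum_enorm_integral_fourier_sq_le (measurable_interpPoint τ) hα
        (g := fun _ => 1) measurable_const (integrable_const _) hN
      simpa [mul_assoc, hX] using this
    calc _ ≤ ∑ k ∈ Finset.Icc (-(N : ℤ)) N,
            (2 * ‖∫ p, (fourier k (interpPoint lam p) : ℂ) ∂π‖ₑ ^ 2 +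
              2 * ‖∫ p, (fourier k (interpPoint 0 p) : ℂ) ∂π‖ₑ ^ 2) :=
          Finset.sum_le_sum fun k _ => enorm_sub_sq_le _ _
      _ ≤ 2 * (36 * X) + 2 * (36 * X) := by
          rw [Finset.sum_add_distrib, ← Finset.mul_sum, ← Finset.mul_sum]
          gcongr
          · exact hone lam ⟨hlam.1, le_rfl⟩
          · exact hone 0 ⟨le_rfl, hlam.1⟩
      _ = 144 * X := by ring
      _ ≤ 1440 * X := by gcongr; norm_num
      _ = _ := by rw [hX, mul_assoc]
  · have hsieve := (BallBound.prod hlam.2 hB).sum_enorm_integral_fourier_sq_le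
      continuous_interpPoint.measurable hα (g := fun w : (ℝ × ℝ) × ℝ => w.1.2 - w.1.1)
      (by fun_prop) (hint.comp_fst _) hN
    have hcost : ∫⁻ w, ‖w.1.2 - w.1.1‖ₑ ^ 2 ∂π.prod (volume.restrict (Set.Ioc 0 lam))
        ≤ transportCost π := by
      rw [lintegral_prod _ (by fun_prop), transportCost]
      refine lintegral_mono fun p => ?_
      simp only [lintegral_const, Measure.restrict_apply_univ, Real.volume_Ioc, sub_zero]
      rw [← enorm_neg, neg_sub]
      exact mul_le_of_le_one_right' (ENNReal.ofReal_le_one.2 hlam.2)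
    -- Here `(2π)² ≤ 40`.
    have hcoef : ∀ k ∈ Finset.Icc (-(N : ℤ)) N,
        ‖(2 * Real.pi * Complex.I * k : ℂ)‖ₑ ^ 2 ≤ 40 * ENNReal.ofReal ((N : ℝ) ^ 2) := by
      intro k hk
      rw [Finset.mem_Icc] at hk
      have hk' : |(k : ℝ)| ≤ N := by exact_mod_cast abs_le.2 hk
      have hn : ‖(2 * Real.pi * Complex.I * k : ℂ)‖ = 2 * Real.pi * |(k : ℝ)| := by
        simp [abs_of_pos Real.pi_pos]
      rw [← ofReal_norm, hn, ← ENNReal.ofReal_pow (by positivity), ← ENNReal.ofReal_ofNat 40,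
        ← ENNReal.ofReal_mul (by norm_num), mul_pow, mul_pow]
      refine ENNReal.ofReal_le_ofReal ?_
      gcongr
      nlinarith [Real.pi_lt_d2, Real.pi_pos]
    calc _ ≤ ∑ k ∈ Finset.Icc (-(N : ℤ)) N, 40 * ENNReal.ofReal ((N : ℝ) ^ 2) *
            ‖∫ w, fourier k (interpPoint w.2 w.1) * ((w.1.2 - w.1.1 : ℝ) : ℂ)
              ∂π.prod (volume.restrict (Set.Ioc 0 lam))‖ₑ ^ 2 := by
          refine Finset.sum_le_sum fun k hk => ?_
          rw [integral_sub_eq_integral_prod hint hlam.1, enorm_mul, mul_pow]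
          exact mul_le_mul_left (hcoef k hk) _
      _ ≤ 40 * ENNReal.ofReal ((N : ℝ) ^ 2) *
            (36 * K * ENNReal.ofReal ((N : ℝ) ^ (1 - α)) * transportCost π) := by
          rw [← Finset.mul_sum]
          exact mul_le_mul_right (hsieve.trans (mul_le_mul_right hcost _)) _
      _ = _ := by ring

/-- Summation of the dyadic blocks. The geometric series converges because
`θ < s - (1 - α) / 2`. -/
theorem exists_tsum_enorm_fourier_sub_le {s α θ lam : ℝ} (hs : s ∈ Set.Ioo (0 : ℝ) 1)
    (hα : α ∈ Set.Icc (0 : ℝ) 1) (hθ0 : 0 ≤ θ) (hθ : θ < s - (1 - α) / 2)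
    (hlam : lam ∈ Set.Icc (0 : ℝ) 1) {K : ℝ≥0∞} (hK : K ≠ ∞) :
    ∃ C : ℝ≥0∞, C ≠ ∞ ∧ ∀ (π : Measure (ℝ × ℝ)) [IsProbabilityMeasure π],
      Integrable (fun p : ℝ × ℝ => p.2 - p.1) π →
      (∀ τ ∈ Set.Icc 0 lam, BallBound π (interpPoint τ) K α) →
      ∑' k : ℤ, ‖(k : ℝ)‖ₑ ^ (-(2 * s)) * ‖∫ p, (fourier k (interpPoint lam p) : ℂ) ∂π -
        ∫ p, (fourier k (interpPoint 0 p) : ℂ) ∂π‖ₑ ^ 2 ≤ C * transportCost π ^ θ := by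
  set q : ℝ := 2 ^ (-(2 * s) + (1 - α) + 2 * θ) with hq
  have hq0 : 0 ≤ q := by positivity
  have hq1 : q < 1 := Real.rpow_lt_one_of_one_lt_of_neg one_lt_two (by linarith)
  have hqsum : ∑' j : ℕ, ENNReal.ofReal q ^ j ≠ ∞ := by
    rw [ENNReal.tsum_geometric, ENNReal.inv_ne_top]
    exact (tsub_pos_of_lt (by rwa [ENNReal.ofReal_lt_one])).ne'
  refine ⟨4 * (1440 * K * ∑' j : ℕ, ENNReal.ofReal q ^ j), by finiteness, fun π _ hint hB => ?_⟩
  refine (tsum_rpow_mul_le_dyadic hs (by simp)).trans ?_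
  rw [mul_assoc]
  refine mul_le_mul_right ?_ _
  rw [mul_right_comm, ← ENNReal.tsum_mul_left]
  refine ENNReal.tsum_le_tsum fun j => ?_
  set t : ℝ := 2 ^ j with ht
  have htpos : 0 < t := by positivity
  have hblock := sum_enorm_fourier_sub_sq_le hint hα hlam hB (N := 2 ^ j) (by positivity)
  have hcast : ((2 ^ j : ℕ) : ℝ) = t := by push_cast; rfl
  rw [hcast] at hblock
  have hθ1 : θ ∈ Set.Icc (0 : ℝ) 1 := ⟨hθ0, by linarith [hs.2, hα.2]⟩
  have hpow : ENNReal.ofReal (t ^ (-(2 * s))) * ENNReal.ofReal (t ^ (1 - α)) *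
      ENNReal.ofReal (t ^ 2) ^ θ = ENNReal.ofReal q ^ j := by
    rw [ENNReal.ofReal_rpow_of_pos (by positivity), ← ENNReal.ofReal_mul (by positivity),
      ← ENNReal.ofReal_mul (by positivity), ← ENNReal.ofReal_pow hq0]
    congr 1
    rw [← Real.rpow_natCast t 2, ← Real.rpow_mul htpos.le, ← Real.rpow_add htpos,
      ← Real.rpow_add htpos, hq, ht, ← Real.rpow_natCast 2 j, ← Real.rpow_mul zero_le_two,
      ← Real.rpow_natCast _ j, ← Real.rpow_mul zero_le_two, mul_comm]
    norm_num
  calc _ ≤ ENNReal.ofReal (t ^ (-(2 * s))) * (1440 * K * ENNReal.ofReal (t ^ (1 - α)) *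
          (ENNReal.ofReal (t ^ 2) * transportCost π) ^ θ) := by
        refine mul_le_mul_right (hblock.trans ?_) _
        exact mul_le_mul_right (min_one_le_rpow hθ1 _) _
    _ = 1440 * K * transportCost π ^ θ * (ENNReal.ofReal (t ^ (-(2 * s))) *
          ENNReal.ofReal (t ^ (1 - α)) * ENNReal.ofReal (t ^ 2) ^ θ) := by
        rw [ENNReal.mul_rpow_of_nonneg _ _ hθ0]; ring
    _ = _ := by rw [hpow]

/-! ### The Sobolev norm and the Wasserstein distance -/

theorem measureFourierCoeff_sub (μ₁ μ₂ : Measure UnitAddCircle) [IsFiniteMeasure μ₁]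
    [IsFiniteMeasure μ₂] (k : ℤ) :
    measureFourierCoeff (μ₁.toSignedMeasure - μ₂.toSignedMeasure) k
      = ∫ x, fourier k x ∂μ₁ - ∫ x, fourier k x ∂μ₂ := by
  have h : ∀ (m : Measure UnitAddCircle) [IsFiniteMeasure m],
      m.toSignedMeasure.Integrable fun x => (fourier k x : ℂ) := by
    intro m _
    rw [VectorMeasure.Integrable, Measure.variation_toSignedMeasure]
    exact integrable_fourier_comp measurable_id k
  rw [measureFourierCoeff, VectorMeasure.integral_sub_vectorMeasure (h μ₁) (h μ₂),
    VectorMeasure.integral_toSignedMeasure, VectorMeasure.integral_toSignedMeasure]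

theorem IsOptimalPlan.wassersteinDist_eq {π : Measure (ℝ × ℝ)} {μ₁ μ₂ : Measure ℝ}
    (h : IsOptimalPlan π μ₁ μ₂) : wassersteinDist μ₁ μ₂ = transportCost π ^ (1 / 2 : ℝ) := by
  rw [wassersteinDist]
  congr 1
  exact le_antisymm (iInf₂_le π h.1) (le_iInf₂ h.2)

theorem mainTheorem8 (s α : ℝ) (hs : s ∈ Set.Ioo (0 : ℝ) 1) (hα : α ∈ Set.Icc (0 : ℝ) 1)
    (hαs : 1 - 2 * s < α)
    (μ : Measure UnitAddCircle) [IsProbabilityMeasure μ] (hμ : UpperAhlforsRegular α μ)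
    (lam : ℝ) (hlam : lam ∈ Set.Ioo (0 : ℝ) 1)
    (θ : ℝ) (hθ : θ < s - (1 - α) / 2) :
    ∃ C : ℝ≥0, ∀ (ν : Measure UnitAddCircle) [IsProbabilityMeasure ν]
      (a : ℝ) (μ₀ ν₀ : Measure ℝ), IsRepresentative a μ₀ μ → IsRepresentative a ν₀ ν →
      ∀ (π : Measure (ℝ × ℝ)) [IsFiniteMeasure π], IsOptimalPlan π μ₀ ν₀ →
        negSobolevNorm s
            (μ.toSignedMeasure - (toTorus (mcCannInterpolant lam π)).toSignedMeasure)
          ≤ C * wassersteinDist μ₀ ν₀ ^ θ := by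
  have hlam' : lam ∈ Set.Icc (0 : ℝ) 1 := ⟨hlam.1.le, hlam.2.le⟩
  obtain ⟨M, hMtop, hM⟩ := hμ.exists_measure_ball_le hα
  -- As `W ≤ 1`, the claim for `max θ 0` implies the claim for `θ`.
  set θ' := max θ 0
  have hθ'0 : 0 ≤ θ' := le_max_right _ _
  have hθ'1 : θ' < s - (1 - α) / 2 := max_lt hθ (by linarith)
  obtain ⟨C, hC, hmain⟩ := exists_tsum_enorm_fourier_sub_le hs hα hθ'0 hθ'1 hlam'
    (K := 3 * (M * ENNReal.ofReal ((4 / (1 - lam)) ^ α))) (by finiteness)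
  refine ⟨(C ^ (1 / 2 : ℝ)).toNNReal, ?_⟩
  intro ν _ a μ₀ ν₀ hμ₀ hν₀ π _ hopt
  obtain ⟨h₁, h₂⟩ := hopt.1
  have hmk : Measurable fun x : ℝ => (x : UnitAddCircle) := (AddCircle.continuous_mk' 1).measurable
  have hfst : π.map (fun p => (p.1 : UnitAddCircle)) = μ := by
    rw [← hμ₀.2, ← h₁, toTorus, Measure.map_map hmk measurable_fst]
    rfl
  have hprob : IsProbabilityMeasure π := by
    refine ⟨?_⟩
    have h : μ Set.univ = 1 := measure_univ
    have hmf : Measurable fun p : ℝ × ℝ => (p.1 : UnitAddCircle) := hmk.comp measurable_fst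
    rwa [← hfst, Measure.map_apply hmf .univ] at h
  have hper : ∀ᵐ p ∂π, p.1 ∈ Set.Icc a (a + 1) ∧ p.2 ∈ Set.Icc a (a + 1) := by
    have e₁ : ∀ᵐ x ∂π.map Prod.fst, x ∈ Set.Icc a (a + 1) := by rw [h₁]; exact hμ₀.1
    have e₂ : ∀ᵐ x ∂π.map Prod.snd, x ∈ Set.Icc a (a + 1) := by rw [h₂]; exact hν₀.1
    exact (ae_of_ae_map measurable_fst.aemeasurable e₁).and
      (ae_of_ae_map measurable_snd.aemeasurable e₂)
  have hdisp : ∀ᵐ p ∂π, |p.2 - p.1| ≤ 1 := by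
    filter_upwards [hper] with p hp
    rw [abs_le]; constructor <;> linarith [hp.1.1, hp.1.2, hp.2.1, hp.2.2]
  have hint : Integrable (fun p : ℝ × ℝ => p.2 - p.1) π :=
    Integrable.of_bound (by fun_prop) 1 hdisp
  have hcost : transportCost π ≤ 1 := by
    calc transportCost π ≤ ∫⁻ _, 1 ∂π := by
          refine lintegral_mono_ae ?_
          filter_upwards [hdisp] with p hp
          rw [Real.enorm_eq_ofReal_abs, abs_sub_comm]
          exact pow_le_one₀ zero_le (ENNReal.ofReal_le_one.2 hp)
      _ = 1 := by simp
  have hmono := hopt.ae_monotone (ne_top_of_le_ne_top ENNReal.one_ne_top hcost)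
  have hbound := hmain π hint fun τ hτ =>
    ballBound_interpPoint hfst hmono hM hper hlam.2 hτ
  have hcoeff : ∀ k : ℤ, ‖measureFourierCoeff (μ.toSignedMeasure -
      (toTorus (mcCannInterpolant lam π)).toSignedMeasure) k‖ₑ =
      ‖∫ p, (fourier k (interpPoint lam p) : ℂ) ∂π -
        ∫ p, (fourier k (interpPoint 0 p) : ℂ) ∂π‖ₑ := by
    intro k
    have hz : toTorus (mcCannInterpolant lam π) = π.map (interpPoint lam) := by
      rw [toTorus, mcCannInterpolant, Measure.map_map hmk (by fun_prop)]
      rfl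
    have hx : μ = π.map (interpPoint 0) := by
      rw [← hfst]; congr 1; ext p; simp [interpPoint]
    rw [measureFourierCoeff_sub, ← enorm_neg, neg_sub, hz]
    conv_lhs => rw [hx]
    rw [integral_map (measurable_interpPoint _).aemeasurable
        (fourier k).continuous.aestronglyMeasurable,
      integral_map (measurable_interpPoint _).aemeasurable
        (fourier k).continuous.aestronglyMeasurable]
  rw [negSobolevNorm, hopt.wassersteinDist_eq, ENNReal.coe_toNNReal (by finiteness)]
  simp_rw [hcoeff]
  calc _ ≤ (C * transportCost π ^ θ') ^ (1 / 2 : ℝ) := ENNReal.rpow_le_rpow hbound (by norm_num)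
    _ = C ^ (1 / 2 : ℝ) * (transportCost π ^ (1 / 2 : ℝ)) ^ θ' := by
        rw [ENNReal.mul_rpow_of_nonneg _ _ (by norm_num), ← ENNReal.rpow_mul, ← ENNReal.rpow_mul,
          mul_comm θ']
    _ ≤ C ^ (1 / 2 : ℝ) * (transportCost π ^ (1 / 2 : ℝ)) ^ θ := by
        refine mul_le_mul_right ?_ _
        exact ENNReal.rpow_le_rpow_of_exponent_ge (ENNReal.rpow_le_one hcost (by norm_num))
          (le_max_left _ _)
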